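/- There is an absolute constant $\varepsilon_0>0$ such that for every $0<\varepsilon<\varepsilon_0$ the following holds, with $\eta=\varepsilon^9$. Let $\frac16<\rho<\frac15$, let $N\ge 1$ and $Y$ be real numbers, and put $L_1=2N^{\rho-\varepsilon/2}$ and $L=N^{\rho-\varepsilon/3}$. Let $g(x)=\frac aq x^2+\beta x+\gamma$, where $\beta,\gamma\in\mathbb R$ and $\frac aq$ is a fraction in lowest terms with $q\ge1$ and $L_1^{1/2}N\ll q\ll L_1^{1/2}N$. Suppose that $N^{\rho}\ll Y\ll N^{1-4\rho}$. For each integer $y$ with $Y<y\le 2Y$ let $I(y)$ be an arbitrary subinterval of $\left(\frac N{2y},\frac Ny\right]$, and let $c_\ell,a_x,b_y$ be complex numbers with $|c_\ell|\le1$, $|a_x|\le1$, $|b_y|\le1$. Then, writing $e(\theta)=e^{2\pi i\theta}$, $$\sum_{1\le \ell\le L}c_\ell\sum_{Y<y\le 2Y}b_y\sum_{x\in I(y)}a_x\,e(\ell g(xy))\ll N^{1-10\eta},$$ where $\ell,y,x$ run over integers and the implied constant depends only on $\varepsilon$ and on the implied constants in the hypotheses on $q$ and $Y$. -/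

import Mathlib

namespace TypeII

open Classical in
/-- The natural numbers `n` with `1 ≤ n ≤ t` and `n ∈ J`, for a set `J` of real numbers. -/
noncomputable def natsUpTo (t : ℝ) (J : Set ℝ) : Finset ℕ :=
  (Finset.Icc 1 ⌊t⌋₊).filter fun n => (n : ℝ) ∈ J

/-- The natural numbers `y ∼ Y`, that is, `Y < y ≤ 2 Y`. -/
noncomputable def dyadic (Y : ℝ) : Finset ℕ :=
  Finset.Ioc ⌊Y⌋₊ ⌊2 * Y⌋₊

/-- `e(θ) = exp(2 π i θ)`. -/
noncomputable def e (θ : ℝ) : ℂ :=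
  Complex.exp (2 * Real.pi * Complex.I * θ)

/-- The polynomial `g(x) = (a/q) x² + β x + γ`. -/
noncomputable def g (a : ℤ) (q : ℕ) (β γ x : ℝ) : ℝ :=
  (a : ℝ) / (q : ℝ) * x ^ 2 + β * x + γ

/-- `L₁ = 2 N^(ρ - ε/2)`. -/
noncomputable def L₁ (ρ ε N : ℝ) : ℝ := 2 * N ^ (ρ - ε / 2)

/-- `L = N^(ρ - ε/3)`. -/
noncomputable def L (ρ ε N : ℝ) : ℝ := N ^ (ρ - ε / 3)

/-- `J` is an interval (of any kind, possibly empty) contained in `(N/(2m), N/m]`. -/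
def IsSubinterval (N : ℝ) (m : ℕ) (J : Set ℝ) : Prop :=
  J.OrdConnected ∧ J ⊆ Set.Ioc (N / (2 * m)) (N / m)

/-- The bilinear sum `∑_{ℓ ≤ L} c_ℓ ∑_{y ∼ Y} b_y ∑_{x ∈ I(y)} a_x e(ℓ g(xy))`. The cut-off
`x ≤ N/y` is implied by `x ∈ I(y)` and only serves to make the index set finite. -/
noncomputable def bilinearSum (ρ ε N Y : ℝ) (G : ℝ → ℝ) (I : ℕ → Set ℝ) (c b a : ℕ → ℂ) : ℂ :=
  ∑ ℓ ∈ Finset.Icc 1 ⌊L ρ ε N⌋₊, c ℓ *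
    ∑ y ∈ dyadic Y, b y *
      ∑ x ∈ natsUpTo (N / y) (I y), a x * e (ℓ * G ((x : ℝ) * (y : ℝ)))

theorem mem_dyadic {Y : ℝ} (hY : 0 ≤ Y) (y : ℕ) :
    y ∈ dyadic Y ↔ Y < y ∧ (y : ℝ) ≤ 2 * Y := by
  rw [dyadic, Finset.mem_Ioc, Nat.floor_lt hY, Nat.le_floor_iff (by positivity)]

/-- The index set of the inner sum is exactly the set of natural numbers in `I(y)`. -/
theorem mem_natsUpTo {N : ℝ} {m : ℕ} {J : Set ℝ} (hN : 0 < N) (hm : 0 < m)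
    (hJ : IsSubinterval N m J) (x : ℕ) : x ∈ natsUpTo (N / m) J ↔ (x : ℝ) ∈ J := by
  simp only [natsUpTo, Finset.mem_filter, Finset.mem_Icc]
  refine ⟨fun h => h.2, fun h => ⟨?_, h⟩⟩
  have hx := hJ.2 h
  have hm' : (0 : ℝ) < m := by exact_mod_cast hm
  have h0 : (0 : ℝ) < x := lt_trans (by positivity) hx.1
  exact ⟨by exact_mod_cast h0, Nat.le_floor hx.2⟩

end TypeII

namespace TypeII

/-! The argument is two applications of Cauchy–Schwarz around Weyl differencing. Write X = N/Y, M =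
2Y, H = LM², and let D ≪ N^κ bound the divisor functions that occur.

Cauchy–Schwarz over x removes the weights on x and leaves pairs (ℓ, y), (ℓ', y'). Each pair carries
a quadratic sum over an interval of x, with leading coefficient ha/q where h = ℓy² - ℓ'y'²
(`norm_sum_mul_sum_sq_le`). Pairs with h = 0 are bounded trivially; the divisor bound shows there
are at most LMD of them. For h ≠ 0, let r(h) be the number of pairs. A second Cauchy–Schwarz
separates r(h) from the Weyl bound W(h) for the squared quadratic sum: ∑ r(h) √W(h) ≤ (∑
r(h)²)^{1/2} (∑ W(h))^{1/2}.

The energy ∑ r(h)² is ≪ L³M²D² (`sum_diffCount_sq_le`). Fixing ℓ by Cauchy–Schwarz reduces it to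
counting ℓ(y² - y'²) = p - p' with p, p' values of ℓy². A nonzero right side leaves at most D²
choices of (ℓ, y, y'), by factoring y² - y'²; a zero right side forces y = y'.

The mean ∑ W(h) is near optimal (`sum_weylBound_le`): the products 2dh of shifts and multipliers
cover each nonzero n at most 2D times, and n ↦ na runs over complete residue systems mod q. As X ≪ q
≪ HX, this gives ∑ W(h) ≪ N^{2κ} LYN.

The squared sum is thus ≪ N^κ N²L/Y + N^{2κ} (N³L⁴Y)^{1/2}. With L = N^{ρ-ε/3}, the lower bound on Y
controls the first term and the upper bound the second, each with a power of N to spare. -/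

/-! ### The divisor bound. -/

open Finset in
/-- The divisor bound `d(n) ≪ n^δ`. -/
theorem exists_card_divisors_le (δ : ℝ) (hδ : 0 < δ) :
    ∃ C : ℝ, 1 ≤ C ∧ ∀ n : ℕ, n ≠ 0 → (#n.divisors : ℝ) ≤ C * (n : ℝ) ^ δ := by
  -- By Bernoulli p^{kδ} ≥ 1 + kδ log 2, so this c gives k + 1 ≤ c p^{kδ} at every prime.
  set c : ℝ := max 1 (1 / (δ * Real.log 2)) with hc
  have hl : 0 < Real.log 2 := Real.log_pos (by norm_num)
  have hc1 : 1 ≤ c := le_max_left _ _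
  have hc2 : 1 ≤ c * (δ * Real.log 2) := by
    have : 1 / (δ * Real.log 2) ≤ c := le_max_right _ _
    rwa [div_le_iff₀ (by positivity)] at this
  -- For p ≥ P one has p^δ ≥ 2, and k + 1 ≤ 2^k needs no constant; so c is paid at most P times.
  set P := ⌈(2 : ℝ) ^ (1 / δ)⌉₊ with hP
  refine ⟨c ^ P, one_le_pow₀ hc1, fun n hn => ?_⟩
  have hn' : (n : ℝ) = ∏ p ∈ n.primeFactors, (p : ℝ) ^ (n.factorization p) := by
    conv_lhs => rw [← Nat.prod_factorization_pow_eq_self hn]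
    rw [Finsupp.prod, Nat.support_factorization]
    push_cast
    rfl
  rw [Nat.card_divisors hn, hn', ← Real.finsetProd_rpow _ _ (fun i _ => by positivity)]
  have key : ∀ p ∈ n.primeFactors, ((n.factorization p + 1 : ℕ) : ℝ) ≤
      (if p < P then c else 1) * ((p : ℝ) ^ (n.factorization p)) ^ δ := by
    intro p hp
    have hp2 : 2 ≤ p := (Nat.prime_of_mem_primeFactors hp).two_le
    have hp2' : (2 : ℝ) ≤ p := by exact_mod_cast hp2
    set k := n.factorization p
    have e1 : ((p : ℝ) ^ k) ^ δ = ((p : ℝ) ^ δ) ^ k := by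
      rw [← Real.rpow_natCast, ← Real.rpow_natCast, ← Real.rpow_mul (by positivity),
        ← Real.rpow_mul (by positivity), mul_comm]
    rw [e1]
    push_cast
    split_ifs with h
    · have h1 : 1 + δ * Real.log 2 ≤ (p : ℝ) ^ δ := by
        calc 1 + δ * Real.log 2 ≤ Real.exp (δ * Real.log 2) := by
              linarith [Real.add_one_le_exp (δ * Real.log 2)]
          _ = (2 : ℝ) ^ δ := by rw [Real.rpow_def_of_pos (by norm_num), mul_comm]
          _ ≤ (p : ℝ) ^ δ := Real.rpow_le_rpow (by norm_num) hp2' hδ.le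
      have h2 : 1 + (k : ℝ) * (δ * Real.log 2) ≤ ((p : ℝ) ^ δ) ^ k :=
        (one_add_mul_le_pow (by linarith [mul_pos hδ hl]) k).trans
          (pow_le_pow_left₀ (by positivity) h1 k)
      calc (k : ℝ) + 1 ≤ c * (1 + (k : ℝ) * (δ * Real.log 2)) := by
            have : (k : ℝ) * 1 ≤ k * (c * (δ * Real.log 2)) := by gcongr
            nlinarith
        _ ≤ _ := by gcongr
    · have h1 : (2 : ℝ) ≤ (p : ℝ) ^ δ := by
        have : (2 : ℝ) ^ (1 / δ) ≤ p := (Nat.le_ceil _).trans (by exact_mod_cast not_lt.1 h)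
        calc (2 : ℝ) = ((2 : ℝ) ^ (1 / δ)) ^ δ := by
              rw [← Real.rpow_mul (by norm_num), one_div_mul_cancel hδ.ne', Real.rpow_one]
          _ ≤ _ := Real.rpow_le_rpow (by positivity) this hδ.le
      rw [one_mul]
      calc (k : ℝ) + 1 ≤ (2 : ℝ) ^ k := by exact_mod_cast Nat.lt_two_pow_self
        _ ≤ _ := pow_le_pow_left₀ (by norm_num) h1 k
  push_cast
  calc ∏ p ∈ n.primeFactors, ((n.factorization p : ℝ) + 1)
      ≤ ∏ p ∈ n.primeFactors,
        ((if p < P then c else 1) * ((p : ℝ) ^ (n.factorization p)) ^ δ) :=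
        Finset.prod_le_prod (fun _ _ => by positivity) (fun p hp => by exact_mod_cast key p hp)
    _ = (∏ p ∈ n.primeFactors, if p < P then c else 1) *
        ∏ p ∈ n.primeFactors, ((p : ℝ) ^ (n.factorization p)) ^ δ := Finset.prod_mul_distrib
    _ ≤ _ := by
        gcongr
        rw [Finset.prod_ite, Finset.prod_const_one, mul_one, Finset.prod_const]
        refine pow_le_pow_right₀ hc1 ?_
        calc _ ≤ #(Finset.range P) := Finset.card_le_card fun p hp => by
              simpa using (Finset.mem_filter.1 hp).2
          _ = P := Finset.card_range P

/-- The integers `m` in a finite set that divide a nonzero `n` number at most `2 d(|n|)`. -/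
theorem card_filter_int_dvd_le (s : Finset ℤ) {n : ℤ} (hn : n ≠ 0) :
    (s.filter (· ∣ n)).card ≤ 2 * n.natAbs.divisors.card := by
  have hsub : s.filter (· ∣ n) ⊆ n.natAbs.divisors.image (fun k : ℕ => (k : ℤ)) ∪
      n.natAbs.divisors.image (fun k : ℕ => -(k : ℤ)) := by
    intro m hm
    have hd : m.natAbs ∈ n.natAbs.divisors :=
      Nat.mem_divisors.2 ⟨Int.natAbs_dvd_natAbs.2 (Finset.mem_filter.1 hm).2,
        Int.natAbs_ne_zero.2 hn⟩
    rw [Finset.mem_union, Finset.mem_image, Finset.mem_image]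
    rcases Int.natAbs_eq m with h | h
    · exact Or.inl ⟨_, hd, h.symm⟩
    · exact Or.inr ⟨_, hd, h.symm⟩
  calc _ ≤ _ := Finset.card_le_card hsub
    _ ≤ _ := Finset.card_union_le _ _
    _ ≤ _ := by
      rw [two_mul]
      exact add_le_add Finset.card_image_le Finset.card_image_le


/-! ### Geometric sums and residues modulo q. -/

/-- The majorant, at the residue class `z`, of geometric sums of length at most `X` with ratio
`e(z / q)`. -/
noncomputable def kernelBound (q X : ℕ) (z : ZMod q) : ℝ :=
  if z = 0 then X else q / 2 * (1 / (z.val : ℝ) + 1 / ((q : ℝ) - z.val))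

theorem kernelBound_nonneg (q X : ℕ) [NeZero q] (z : ZMod q) : 0 ≤ kernelBound q X z := by
  have h : (z.val : ℝ) < q := by exact_mod_cast ZMod.val_lt z
  have h' : (0 : ℝ) < q - z.val := by linarith
  unfold kernelBound
  split_ifs <;> positivity

theorem sum_kernelBound_le (q X : ℕ) [NeZero q] :
    ∑ z : ZMod q, kernelBound q X z ≤ X + q * (1 + Real.log q) := by
  have hq : 0 < q := Nat.pos_of_ne_zero (NeZero.ne q)
  have h1 : ∑ z : ZMod q, kernelBound q X z = ∑ k ∈ Finset.range q,
      if k = 0 then (X : ℝ) else q / 2 * (1 / (k : ℝ) + 1 / ((q : ℝ) - k)) := by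
    refine Finset.sum_bij (fun z _ => z.val) (fun z _ => Finset.mem_range.2 (ZMod.val_lt z))
      (fun z _ w _ h => ZMod.val_injective q h)
      (fun k hk => ⟨(k : ZMod q), Finset.mem_univ _, ZMod.val_cast_of_lt (Finset.mem_range.1 hk)⟩)
      (fun z _ => ?_)
    simp only [kernelBound, ZMod.val_eq_zero]
  obtain ⟨m, rfl⟩ : ∃ m, q = m + 1 := ⟨q - 1, by omega⟩
  rw [h1, Finset.sum_range_succ']
  -- With q = m + 1, the term 1/(q - (k+1)) is the reflection k ↦ m - 1 - k of 1/(k+1), so both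
  -- halves are the same harmonic sum.
  have h2 : ∀ k ∈ Finset.range m,
      (if k + 1 = 0 then (X : ℝ) else ((m + 1 : ℕ) : ℝ) / 2 *
        (1 / ((k + 1 : ℕ) : ℝ) + 1 / (((m + 1 : ℕ) : ℝ) - (k + 1 : ℕ)))) =
      ((m + 1 : ℕ) : ℝ) / 2 * (1 / ((k : ℝ) + 1) + 1 / ((m - 1 - k : ℕ) + 1 : ℝ)) := by
    intro k hk
    have hk := Finset.mem_range.1 hk
    rw [if_neg (by omega)]
    have : ((m - 1 - k : ℕ) : ℝ) = m - 1 - k := by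
      rw [Nat.cast_sub (by omega), Nat.cast_sub (by omega)]; simp
    rw [this]
    push_cast
    congr 3
    ring
  rw [Finset.sum_congr rfl h2, ← Finset.mul_sum, Finset.sum_add_distrib,
    Finset.sum_range_reflect (fun k => 1 / ((k : ℝ) + 1)) m]
  have h3 : ∑ k ∈ Finset.range m, 1 / ((k : ℝ) + 1) ≤ 1 + Real.log ((m + 1 : ℕ) : ℝ) := by
    have h4 : ∑ k ∈ Finset.range m, 1 / ((k : ℝ) + 1) = ((harmonic m : ℚ) : ℝ) := by
      simp [harmonic]
    rw [h4]
    rcases Nat.eq_zero_or_pos m with rfl | hm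
    · simp
    · refine (harmonic_le_one_add_log m).trans ?_
      gcongr
      omega
  simp only [if_true]
  have : (0 : ℝ) ≤ ((m + 1 : ℕ) : ℝ) := by positivity
  nlinarith

/-- A nonnegative function of residue classes mod `q`, summed over `|n| ≤ B`. -/
theorem sum_int_le_periods {q : ℕ} [NeZero q] (f : ZMod q → ℝ) (hf : ∀ z, 0 ≤ f z) (B : ℕ) :
    ∑ n ∈ Finset.Icc (-(B : ℤ)) B, f (n : ZMod q) ≤
      ((2 * (B : ℝ) + 1) / q + 1) * ∑ z, f z := by
  have hq : 0 < q := Nat.pos_of_ne_zero (NeZero.ne q)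
  -- The shift by B only permutes the residues, so each run of q terms is one complete sum.
  have block : ∀ k : ℕ, ∑ i ∈ Finset.range (q * k), f (((i : ℤ) - B : ℤ) : ZMod q) =
      k * ∑ z, f z := by
    intro k
    induction k with
    | zero => simp
    | succ k ih =>
      rw [Nat.mul_succ, Finset.sum_range_add, ih]
      have : ∑ x ∈ Finset.range q, f ((((q * k + x : ℕ) : ℤ) - B : ℤ) : ZMod q) = ∑ z, f z := by
        rw [← Equiv.sum_comp (Equiv.subRight (B : ZMod q)) f]
        symm
        refine Finset.sum_bij (fun z _ => z.val) (fun z _ => Finset.mem_range.2 (ZMod.val_lt z))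
          (fun z _ w _ h => ZMod.val_injective q h)
          (fun k hk => ⟨(k : ZMod q), Finset.mem_univ _,
            ZMod.val_cast_of_lt (Finset.mem_range.1 hk)⟩)
          (fun z _ => ?_)
        simp
      rw [this]
      push_cast
      ring
  have h1 : ∑ n ∈ Finset.Icc (-(B : ℤ)) B, f (n : ZMod q) =
      ∑ i ∈ Finset.range (2 * B + 1), f (((i : ℤ) - B : ℤ) : ZMod q) := by
    symm
    refine Finset.sum_bij (fun i _ => (i : ℤ) - B) ?_ ?_ ?_ ?_
    · intro i hi
      have := Finset.mem_range.1 hi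
      rw [Finset.mem_Icc]
      omega
    · intro i _ j _ h
      have : (i : ℤ) - B = (j : ℤ) - B := h
      omega
    · intro n hn
      have := Finset.mem_Icc.1 hn
      exact ⟨(n + B).toNat, by rw [Finset.mem_range]; omega, by omega⟩
    · intro i _
      rfl
  have h2 : Finset.range (2 * B + 1) ⊆ Finset.range (q * ((2 * B + 1) / q + 1)) := by
    refine Finset.range_subset_range.2 ?_
    have := Nat.div_add_mod (2 * B + 1) q
    have := Nat.mod_lt (2 * B + 1) hq
    rw [Nat.mul_succ]
    omega
  rw [h1]
  refine (Finset.sum_le_sum_of_subset_of_nonneg h2 fun _ _ _ => hf _).trans ?_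
  rw [block]
  refine mul_le_mul_of_nonneg_right ?_ (Finset.sum_nonneg fun _ _ => hf _)
  have : (((2 * B + 1) / q : ℕ) : ℝ) ≤ ((2 * B + 1 : ℕ) : ℝ) / q := Nat.cast_div_le
  push_cast at this ⊢
  linarith

/-- Since a is a unit mod q, multiplication by it permutes the residues and leaves the sum over a
period unchanged. -/
theorem sum_kernelBound_mul_le {q : ℕ} [NeZero q] {a : ℤ} (ha : IsCoprime a (q : ℤ)) (X B : ℕ) :
    ∑ n ∈ Finset.Icc (-(B : ℤ)) B, kernelBound q X ((n * a : ℤ) : ZMod q) ≤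
      ((2 * (B : ℝ) + 1) / q + 1) * (X + q * (1 + Real.log q)) := by
  have hu : IsUnit (a : ZMod q) := by
    obtain ⟨u, v, h⟩ := ha
    have h' := congrArg (Int.cast : ℤ → ZMod q) h
    push_cast at h'
    rw [ZMod.natCast_self, mul_zero, add_zero] at h'
    exact IsUnit.of_mul_eq_one_right _ h'
  have h1 := sum_int_le_periods (fun z : ZMod q => kernelBound q X (z * a))
    (fun z => kernelBound_nonneg q X _) B
  have h2 : ∑ z : ZMod q, kernelBound q X (z * a) = ∑ z : ZMod q, kernelBound q X z :=
    Fintype.sum_bijective (fun z : ZMod q => z * a) (IsUnit.isUnit_iff_mulRight_bijective.1 hu) _ _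
      (fun _ => rfl)
  rw [h2] at h1
  push_cast
  refine h1.trans ?_
  gcongr
  exact sum_kernelBound_le q X

theorem e_add (s t : ℝ) : e (s + t) = e s * e t := by
  rw [e, e, e, ← Complex.exp_add]
  congr 1
  push_cast
  ring

theorem e_int (n : ℤ) : e n = 1 := by
  rw [e, Complex.exp_eq_one_iff]
  exact ⟨n, by push_cast; ring⟩

theorem norm_e (t : ℝ) : ‖e t‖ = 1 := by
  rw [e, show 2 * (Real.pi : ℂ) * Complex.I * t = ((2 * Real.pi * t : ℝ) : ℂ) * Complex.I by
    push_cast; ring]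
  exact Complex.norm_exp_ofReal_mul_I _

theorem conj_e (t : ℝ) : (starRingEnd ℂ) (e t) = e (-t) := by
  rw [e, e, ← Complex.exp_conj]
  congr 1
  simp [Complex.conj_ofNat]

theorem e_nat_mul (n : ℕ) (t : ℝ) : e (t * n) = e t ^ n := by
  rw [e, e, ← Complex.exp_nat_mul]
  congr 1
  push_cast
  ring

theorem norm_e_sub_one (t : ℝ) : ‖e t - 1‖ = 2 * |Real.sin (Real.pi * t)| := by
  rw [e, show 2 * (Real.pi : ℂ) * Complex.I * t = Complex.I * ((2 * Real.pi * t : ℝ) : ℂ) by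
    push_cast; ring, Complex.norm_exp_I_mul_ofReal_sub_one, norm_mul, Real.norm_eq_abs,
    Real.norm_eq_abs]
  norm_num
  congr 2
  ring

/-- Jordan's inequality at whichever of k, q - k is at most q/2. Adding both reciprocals avoids a
minimum and sums easily over residues. -/
theorem inv_sin_le {q k : ℕ} (hk : 0 < k) (hkq : k < q) :
    1 / |Real.sin (Real.pi * (k / q : ℝ))| ≤ q / 2 * (1 / (k : ℝ) + 1 / ((q : ℝ) - k)) := by
  have hq : (0 : ℝ) < q := by exact_mod_cast hk.trans hkq
  have hk' : (0 : ℝ) < k := by exact_mod_cast hk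
  have hkq' : (0 : ℝ) < q - k := by
    have : (k : ℝ) < q := by exact_mod_cast hkq
    linarith
  have hpi := Real.pi_pos
  have main : ∀ x : ℝ, 0 < x → x ≤ q / 2 → Real.sin (Real.pi * (k / q)) =
      Real.sin (Real.pi * (x / q)) → 1 / |Real.sin (Real.pi * (k / q))| ≤ q / 2 * (1 / x) := by
    intro x hx hxq h
    have h2 := Real.mul_le_sin (x := Real.pi * (x / q)) (by positivity) (by
      have : x / q ≤ 1 / 2 := by rw [div_le_iff₀ hq]; linarith
      nlinarith)
    have h3 : 2 / Real.pi * (Real.pi * (x / q)) = 2 * x / q := by field_simp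
    rw [h3] at h2
    rw [h]
    calc 1 / |Real.sin (Real.pi * (x / q))| ≤ 1 / (2 * x / q) :=
          one_div_le_one_div_of_le (by positivity) (h2.trans (le_abs_self _))
      _ = q / 2 * (1 / x) := by field_simp
  rcases le_total (k : ℝ) (q / 2) with h | h
  · refine (main k hk' h rfl).trans ?_
    gcongr
    linarith [one_div_pos.2 hkq']
  · refine (main (q - k) hkq' (by linarith) ?_).trans ?_
    · rw [← Real.sin_pi_sub]
      congr 1
      field_simp
    · gcongr
      linarith [one_div_pos.2 hk']

/-- A sum of `e(m x / q)` over consecutive integers `x` in `[1, X]`. -/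
theorem norm_sum_e_le_kernelBound {q X : ℕ} [NeZero q] (m : ℤ) {J : Finset ℕ}
    (hJ : J ⊆ Finset.Icc 1 X) (hc : (J : Set ℕ).OrdConnected) :
    ‖∑ x ∈ J, e ((m : ℝ) / q * x)‖ ≤ kernelBound q X (m : ZMod q) := by
  have hq : 0 < q := Nat.pos_of_ne_zero (NeZero.ne q)
  have hq' : (0 : ℝ) < q := by exact_mod_cast hq
  unfold kernelBound
  split_ifs with h0
  · calc ‖∑ x ∈ J, e ((m : ℝ) / q * x)‖ ≤ ∑ x ∈ J, ‖e ((m : ℝ) / q * x)‖ := norm_sum_le _ _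
      _ = (J.card : ℝ) := by simp [norm_e]
      _ ≤ X := by exact_mod_cast (Finset.card_le_card hJ).trans (by simp)
  · set k := (m : ZMod q).val with hk
    have hk0 : 0 < k := Nat.pos_of_ne_zero fun h => h0 ((ZMod.val_eq_zero _).1 h)
    have hkq : k < q := ZMod.val_lt _
    have hm : (k : ℤ) = m % q := by rw [hk, ZMod.val_intCast]
    have he : e ((m : ℝ) / q) = e ((k : ℝ) / q) := by
      have h1 : (m : ℝ) = k + q * (m / q : ℤ) := by
        have : m = k + q * (m / q) := by rw [hm]; exact (Int.emod_add_mul_ediv m q).symm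
        exact_mod_cast this
      rw [h1, add_div, mul_div_cancel_left₀ _ hq'.ne', e_add, e_int, mul_one]
    rcases J.eq_empty_or_nonempty with rfl | hne
    · have := kernelBound_nonneg q X (m : ZMod q)
      rw [kernelBound, if_neg h0] at this
      rw [Finset.sum_empty, norm_zero]
      exact this
    have hJe : J = Finset.Ico (J.min' hne) (J.max' hne + 1) := by
      ext x
      rw [Finset.mem_Ico, Nat.lt_succ_iff]
      exact ⟨fun hx => ⟨J.min'_le x hx, J.le_max' x hx⟩,
        fun hx => hc.out (J.min'_mem hne) (J.max'_mem hne) hx⟩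
    have hle : J.min' hne ≤ J.max' hne + 1 := (J.min'_le _ (J.max'_mem hne)).trans (Nat.le_succ _)
    have hs : (∑ x ∈ J, e ((m : ℝ) / q * x)) * (e ((m : ℝ) / q) - 1) =
        e ((m : ℝ) / q) ^ (J.max' hne + 1) - e ((m : ℝ) / q) ^ (J.min' hne) := by
      rw [← geom_sum_Ico_mul _ hle, ← hJe]
      simp_rw [e_nat_mul]
    have hn : ‖∑ x ∈ J, e ((m : ℝ) / q * x)‖ * (2 * |Real.sin (Real.pi * (k / q : ℝ))|) ≤ 2 := by
      rw [← norm_e_sub_one, ← he, ← norm_mul, hs]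
      refine (norm_sub_le _ _).trans ?_
      rw [norm_pow, norm_pow, norm_e]
      norm_num
    have hsin : 0 < |Real.sin (Real.pi * (k / q : ℝ))| := by
      refine abs_pos.2 (Real.sin_pos_of_pos_of_lt_pi (by positivity) ?_).ne'
      have : (k : ℝ) / q < 1 := by
        rw [div_lt_one hq']
        exact_mod_cast hkq
      nlinarith [Real.pi_pos]
    refine le_trans ?_ (inv_sin_le hk0 hkq)
    rw [le_div_iff₀ hsin]
    linarith


/-! ### Weyl differencing and its mean value. -/

/-- Weyl's bound for the square of a quadratic exponential sum with leading coefficient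
congruent to `m / q`. -/
noncomputable def weylBound (q X : ℕ) (m : ℤ) : ℝ :=
  ∑ d ∈ Finset.Icc (-(X : ℤ)) X, kernelBound q X ((2 * d * m : ℤ) : ZMod q)

theorem weylBound_nonneg (q X : ℕ) [NeZero q] (m : ℤ) : 0 ≤ weylBound q X m :=
  Finset.sum_nonneg fun _ _ => kernelBound_nonneg q X _

/-- Opening the square and grouping pairs by their difference d makes the phase linear in the
remaining variable, with slope 2dm/q; φ enters only a factor of modulus one. -/
theorem norm_quadratic_sum_sq_le {q X : ℕ} [NeZero q] (m : ℤ) (φ : ℝ) {J : Finset ℕ}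
    (hJ : J ⊆ Finset.Icc 1 X) (hc : (J : Set ℕ).OrdConnected) :
    ‖∑ x ∈ J, e ((m : ℝ) / q * (x : ℝ) ^ 2 + φ * x)‖ ^ 2 ≤ weylBound q X m := by
  classical
  set z : ℕ → ℂ := fun x => e ((m : ℝ) / q * (x : ℝ) ^ 2 + φ * x) with hz
  have h1 : ‖∑ x ∈ J, z x‖ ^ 2 = ‖∑ w ∈ J ×ˢ J, z w.1 * (starRingEnd ℂ) (z w.2)‖ := by
    rw [Finset.sum_product' J J (fun x y => z x * (starRingEnd ℂ) (z y)),
      ← Finset.sum_mul_sum, ← map_sum, norm_mul, RCLike.norm_conj, sq]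
  have hmaps : ∀ w ∈ J ×ˢ J, (w.1 : ℤ) - w.2 ∈ Finset.Icc (-(X : ℤ)) X := by
    intro w hw
    have h2 := Finset.mem_product.1 hw
    have h3 := Finset.mem_Icc.1 (hJ h2.1)
    have h4 := Finset.mem_Icc.1 (hJ h2.2)
    rw [Finset.mem_Icc]
    omega
  rw [h1, ← Finset.sum_fiberwise_of_maps_to hmaps]
  refine (norm_sum_le _ _).trans (Finset.sum_le_sum fun d _ => ?_)
  -- This is J ∩ (J - d), again a block of consecutive integers, so the geometric sum bound applies.
  set Jd := J.filter fun y : ℕ => ∃ x ∈ J, (x : ℤ) - y = d with hJd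
  have h5 : ∑ w ∈ (J ×ˢ J).filter (fun w => (w.1 : ℤ) - w.2 = d),
      z w.1 * (starRingEnd ℂ) (z w.2) =
      ∑ y ∈ Jd, e ((m : ℝ) / q * (d : ℝ) ^ 2 + φ * d) * e (((2 * d * m : ℤ) : ℝ) / q * y) := by
    refine Finset.sum_bij (fun w _ => w.2) ?_ ?_ ?_ ?_
    · intro w hw
      obtain ⟨hw1, hw2⟩ := Finset.mem_filter.1 hw
      obtain ⟨hx, hy⟩ := Finset.mem_product.1 hw1
      exact Finset.mem_filter.2 ⟨hy, w.1, hx, hw2⟩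
    · intro w hw w' hw' h
      have h6 := (Finset.mem_filter.1 hw).2
      have h7 := (Finset.mem_filter.1 hw').2
      have h8 : w.2 = w'.2 := h
      refine Prod.ext ?_ h
      rw [h8] at h6
      omega
    · intro y hy
      obtain ⟨hy, x, hx, h⟩ := Finset.mem_filter.1 hy
      exact ⟨(x, y), Finset.mem_filter.2 ⟨Finset.mem_product.2 ⟨hx, hy⟩, h⟩, rfl⟩
    · intro w hw
      have h6 : (w.1 : ℝ) = w.2 + d := by
        have := (Finset.mem_filter.1 hw).2
        have : (w.1 : ℤ) = w.2 + d := by omega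
        exact_mod_cast this
      simp only [hz]
      rw [conj_e, ← e_add, ← e_add, h6]
      congr 1
      push_cast
      ring
  rw [h5, ← Finset.mul_sum, norm_mul, norm_e, one_mul]
  refine norm_sum_e_le_kernelBound _ ((Finset.filter_subset _ _).trans hJ) ⟨?_⟩
  intro y hy y' hy' t ht
  obtain ⟨hy, x, hx, h⟩ := Finset.mem_filter.1 (Finset.mem_coe.1 hy)
  obtain ⟨hy', x', hx', h'⟩ := Finset.mem_filter.1 (Finset.mem_coe.1 hy')
  have ht1 := ht.1
  have ht2 := ht.2
  refine Finset.mem_coe.2 (Finset.mem_filter.2 ⟨hc.out hy hy' ht, (t + d).toNat, ?_, by omega⟩)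
  exact hc.out hx hx' ⟨by omega, by omega⟩

/-- The mean value of Weyl's bound over nonzero multipliers `h`. -/
theorem sum_weylBound_le {q : ℕ} [NeZero q] {a : ℤ} (ha : IsCoprime a (q : ℤ)) (X H : ℕ) {D : ℝ} (hD0 : 0 ≤ D)
    (hD : ∀ n : ℕ, n ≠ 0 → n ≤ 2 * H * X → (n.divisors.card : ℝ) ≤ D) :
    ∑ h ∈ (Finset.Icc (-(H : ℤ)) H).erase 0, weylBound q X (h * a) ≤
      2 * H * X + 2 * D * (((4 * (H : ℝ) * X + 1) / q + 1) * (X + q * (1 + Real.log q))) := by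
  classical
  set S := (Finset.Icc (-(H : ℤ)) H).erase 0 with hS
  set T := Finset.Icc (-(X : ℤ)) X with hT
  set f : ℤ → ℝ := fun n => kernelBound q X ((n * a : ℤ) : ZMod q) with hf
  have hf0 : ∀ n, 0 ≤ f n := fun n => kernelBound_nonneg q X _
  have hST : ∀ h ∈ S, h ≠ 0 ∧ -(H : ℤ) ≤ h ∧ h ≤ H := fun h hh =>
    ⟨(Finset.mem_erase.1 hh).1, Finset.mem_Icc.1 (Finset.mem_erase.1 hh).2⟩
  have hcard : S.card = 2 * H := by
    rw [hS, Finset.card_erase_of_mem (by rw [Finset.mem_Icc]; omega), Int.card_Icc]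
    omega
  have h1 : ∀ h ∈ S, weylBound q X (h * a) = X + ∑ d ∈ T.erase 0, f (2 * d * h) := by
    intro h _
    have h0 : (0 : ℤ) ∈ T := by rw [hT, Finset.mem_Icc]; omega
    rw [weylBound, ← hT, ← Finset.add_sum_erase T _ h0]
    congr 1
    · simp [kernelBound]
    · refine Finset.sum_congr rfl fun d _ => ?_
      simp only [hf]
      congr 2
      ring
  have hmaps : ∀ w ∈ S ×ˢ T.erase 0, 2 * w.2 * w.1 ∈
      (Finset.Icc (-((2 * H * X : ℕ) : ℤ)) (2 * H * X : ℕ)).erase 0 := by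
    intro w hw
    obtain ⟨hw1, hw2⟩ := Finset.mem_product.1 hw
    obtain ⟨h0, h2, h3⟩ := hST _ hw1
    obtain ⟨d0, h4⟩ := Finset.mem_erase.1 hw2
    obtain ⟨h4, h5⟩ := Finset.mem_Icc.1 h4
    refine Finset.mem_erase.2 ⟨by positivity, ?_⟩
    rw [Finset.mem_Icc, ← abs_le]
    push_cast
    rw [abs_mul, abs_mul, abs_two]
    have h6 : |w.2| ≤ X := abs_le.2 ⟨h4, h5⟩
    have h7 : |w.1| ≤ H := abs_le.2 ⟨h2, h3⟩
    calc 2 * |w.2| * |w.1| ≤ 2 * X * H := by gcongr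
      _ = 2 * H * X := by ring
  have h2 : ∑ h ∈ S, ∑ d ∈ T.erase 0, f (2 * d * h) ≤
      2 * D * ∑ n ∈ Finset.Icc (-((2 * H * X : ℕ) : ℤ)) (2 * H * X : ℕ), f n := by
    rw [← Finset.sum_product' S (T.erase 0) (fun h d => f (2 * d * h)),
      ← Finset.sum_fiberwise_of_maps_to hmaps, Finset.mul_sum]
    have hDn : ∀ n ∈ (Finset.Icc (-((2 * H * X : ℕ) : ℤ)) (2 * H * X : ℕ)).erase 0,
        (n.natAbs.divisors.card : ℝ) ≤ D := by
      intro n hn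
      obtain ⟨hn0, hn⟩ := Finset.mem_erase.1 hn
      rw [Finset.mem_Icc] at hn
      exact hD _ (Int.natAbs_ne_zero.2 hn0) (by omega)
    calc _ ≤ ∑ n ∈ (Finset.Icc (-((2 * H * X : ℕ) : ℤ)) (2 * H * X : ℕ)).erase 0,
          2 * D * f n := by
          refine Finset.sum_le_sum fun n hn => ?_
          have hn0 := (Finset.mem_erase.1 hn).1
          rw [Finset.sum_congr rfl (g := fun _ => f n)
            (fun w hw => by rw [(Finset.mem_filter.1 hw).2]), Finset.sum_const, nsmul_eq_mul]
          refine mul_le_mul_of_nonneg_right ?_ (hf0 n)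
          -- In 2dh = n the factor h divides n and, being nonzero, determines d.
          have hinj : ((S ×ˢ T.erase 0).filter fun w => 2 * w.2 * w.1 = n).card ≤
              (S.filter (· ∣ n)).card := by
            refine Finset.card_le_card_of_injOn Prod.fst ?_ ?_
            · intro w hw
              obtain ⟨hw1, hw2⟩ := Finset.mem_filter.1 (Finset.mem_coe.1 hw)
              exact Finset.mem_coe.2 (Finset.mem_filter.2
                ⟨(Finset.mem_product.1 hw1).1, ⟨2 * w.2, by rw [← hw2]; ring⟩⟩)
            · intro w hw w' hw' h
              obtain ⟨hw1, hw2⟩ := Finset.mem_filter.1 (Finset.mem_coe.1 hw)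
              obtain ⟨_, hw4⟩ := Finset.mem_filter.1 (Finset.mem_coe.1 hw')
              refine Prod.ext h ?_
              have h0 := (hST _ (Finset.mem_product.1 hw1).1).1
              have h : w.1 = w'.1 := h
              rw [← hw2, ← h] at hw4
              have := mul_right_cancel₀ h0 hw4
              omega
          have := hinj.trans (card_filter_int_dvd_le S hn0)
          calc _ ≤ ((2 * n.natAbs.divisors.card : ℕ) : ℝ) := by exact_mod_cast this
            _ ≤ 2 * D := by push_cast; linarith [hDn n hn]
      _ ≤ _ := by
          rw [← Finset.mul_sum, ← Finset.mul_sum]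
          exact mul_le_mul_of_nonneg_left (Finset.sum_le_sum_of_subset_of_nonneg
            (Finset.erase_subset 0 _) fun n _ _ => hf0 n) (by positivity)
  rw [Finset.sum_congr rfl h1, Finset.sum_add_distrib, Finset.sum_const, hcard, nsmul_eq_mul]
  have h3 : ∑ n ∈ Finset.Icc (-((2 * H * X : ℕ) : ℤ)) (2 * H * X : ℕ), f n ≤
      ((4 * (H : ℝ) * X + 1) / q + 1) * (X + q * (1 + Real.log q)) := by
    refine (sum_kernelBound_mul_le ha X (2 * H * X)).trans (le_of_eq ?_)
    push_cast
    ring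
  have h4 : ((2 * H : ℕ) : ℝ) * X = 2 * H * X := by push_cast; ring
  rw [h4]
  exact add_le_add le_rfl (h2.trans (mul_le_mul_of_nonneg_left h3 (by positivity)))


/-! ### Energy of the differences ℓy² - ℓ'y'². -/

open Finset in
theorem sum_card_fiber_sq_le {α β : Type*} [DecidableEq β] (s : Finset α) (φ : α → β)
    (T : Finset β) :
    ∑ b ∈ T, #{x ∈ s | φ x = b} ^ 2 ≤ #{w ∈ s ×ˢ s | φ w.1 = φ w.2} := by
  classical
  set F : Finset (α × α) := {w ∈ s ×ˢ s | φ w.1 = φ w.2} with hF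
  calc ∑ b ∈ T, #{x ∈ s | φ x = b} ^ 2 = ∑ b ∈ T, #{w ∈ F | φ w.1 = b} := by
        refine Finset.sum_congr rfl fun b _ => ?_
        rw [sq, ← Finset.card_product]
        congr 1
        ext w
        simp only [hF, Finset.mem_product, Finset.mem_filter]
        constructor
        · rintro ⟨⟨h1, h2⟩, h3, h4⟩
          exact ⟨⟨⟨h1, h3⟩, h2.trans h4.symm⟩, h2⟩
        · rintro ⟨⟨⟨h1, h3⟩, h4⟩, h2⟩
          exact ⟨⟨h1, h2⟩, h3, h4.symm.trans h2⟩
    _ = #{w ∈ F | φ w.1 ∈ T} := by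
        rw [Finset.card_eq_sum_card_fiberwise (f := fun w : α × α => φ w.1) (t := T)
          (s := F.filter fun w => φ w.1 ∈ T) (fun w hw => (Finset.mem_filter.1 hw).2)]
        refine Finset.sum_congr rfl fun b hb => ?_
        congr 1
        ext w
        simp only [Finset.mem_filter]
        constructor
        · rintro ⟨h1, h2⟩
          exact ⟨⟨h1, h2 ▸ hb⟩, h2⟩
        · rintro ⟨⟨h1, _⟩, h2⟩
          exact ⟨h1, h2⟩
    _ ≤ #F := Finset.card_le_card (Finset.filter_subset _ _)

/-- The integer `ℓ y²` attached to a pair `(ℓ, y)`. -/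
def mulSq (p : ℕ × ℕ) : ℤ := p.1 * (p.2 : ℤ) ^ 2

open Finset in
/-- The number of ways to write `k` as `ℓ y² - ℓ' y'²`. -/
def diffCount (P : Finset (ℕ × ℕ)) (k : ℤ) : ℕ :=
  #{w ∈ P ×ˢ P | mulSq w.1 - mulSq w.2 = k}

variable {Λ M : ℕ} {Y : Finset ℕ} {D : ℝ}

open Finset in
theorem card_pairs_le (hY : Y ⊆ Icc 1 M) : #(Icc 1 Λ ×ˢ Y) ≤ Λ * M := by
  rw [Finset.card_product, Nat.card_Icc, Nat.add_sub_cancel]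
  exact Nat.mul_le_mul_left _ ((Finset.card_le_card hY).trans (by simp))

-- Given (ℓ, y), any y' with ℓ'y'² = ℓy² divides this nonzero number and determines ℓ'.
open Finset in
theorem diffCount_zero_le (hY : Y ⊆ Icc 1 M) (hD0 : 0 ≤ D)
    (hD : ∀ n : ℕ, n ≠ 0 → n ≤ Λ * M ^ 2 → (#n.divisors : ℝ) ≤ D) :
    (diffCount (Icc 1 Λ ×ˢ Y) 0 : ℝ) ≤ Λ * M * D := by
  classical
  set P := Icc 1 Λ ×ˢ Y with hP
  have hfib : ∀ p ∈ P, (#{p' ∈ P | mulSq p - mulSq p' = 0} : ℝ) ≤ D := by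
    intro p hp
    obtain ⟨h1, h2⟩ := Finset.mem_product.1 hp
    have h1 := Finset.mem_Icc.1 h1
    have h2 := Finset.mem_Icc.1 (hY h2)
    have hpos : p.1 * p.2 ^ 2 ≠ 0 := by
      have : 0 < p.1 := h1.1
      have : 0 < p.2 := h2.1
      positivity
    have hle : p.1 * p.2 ^ 2 ≤ Λ * M ^ 2 :=
      Nat.mul_le_mul h1.2 (Nat.pow_le_pow_left h2.2 2)
    refine le_trans ?_ (hD _ hpos hle)
    norm_cast
    have heq : ∀ p' ∈ ({p' ∈ P | mulSq p - mulSq p' = 0} : Finset (ℕ × ℕ)),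
        p'.1 * p'.2 ^ 2 = p.1 * p.2 ^ 2 := by
      intro p' hp'
      have := sub_eq_zero.1 (Finset.mem_filter.1 hp').2
      simp only [mulSq] at this
      exact_mod_cast this.symm
    refine Finset.card_le_card_of_injOn Prod.snd ?_ ?_
    · intro p' hp'
      exact Finset.mem_coe.2 (Nat.mem_divisors.2
        ⟨⟨p'.1 * p'.2, by rw [← heq p' hp']; ring⟩, hpos⟩)
    · intro p' hp' p'' hp'' h
      have h : p'.2 = p''.2 := h
      have h3 := (heq p' hp').trans (heq p'' hp'').symm
      have h4 : 0 < p''.2 := (Finset.mem_Icc.1 (hY (Finset.mem_product.1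
        (Finset.mem_filter.1 (Finset.mem_coe.1 hp'')).1).2)).1
      rw [h] at h3
      exact Prod.ext (Nat.eq_of_mul_eq_mul_right (by positivity) h3) h
  have h0 : diffCount P 0 = ∑ p ∈ P, #{p' ∈ P | mulSq p - mulSq p' = 0} := by
    rw [diffCount, Finset.card_filter, Finset.sum_product]
    simp only [Finset.card_filter]
  rw [h0]
  push_cast
  calc _ ≤ ∑ p ∈ P, D := Finset.sum_le_sum hfib
    _ = (#P : ℝ) * D := by rw [Finset.sum_const, nsmul_eq_mul]
    _ ≤ ((Λ * M : ℕ) : ℝ) * D := by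
        gcongr
        exact card_pairs_le hY
    _ = _ := by push_cast; ring

open Finset in
/-- Solutions of `ℓ (y² - y'²) = k` with `k ≠ 0` are determined by the divisors `ℓ` and `y + y'`
of `k`. -/
theorem card_mul_sq_sub_sq_le {k : ℤ} (hk : k ≠ 0)
    (hD : (#k.natAbs.divisors : ℝ) ≤ D) :
    (#{t ∈ Icc 1 Λ ×ˢ (Y ×ˢ Y) | mulSq (t.1, t.2.1) - mulSq (t.1, t.2.2) = k} : ℝ) ≤ D ^ 2 := by
  classical
  have hfac : ∀ t ∈ ({t ∈ Icc 1 Λ ×ˢ (Y ×ˢ Y) |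
      mulSq (t.1, t.2.1) - mulSq (t.1, t.2.2) = k} : Finset (ℕ × ℕ × ℕ)),
      (t.1 : ℤ) * ((t.2.1 + t.2.2 : ℕ) : ℤ) * ((t.2.1 : ℤ) - t.2.2) = k := by
    intro t ht
    rw [← (Finset.mem_filter.1 ht).2]
    simp only [mulSq]
    push_cast
    ring
  have hcard : #{t ∈ Icc 1 Λ ×ˢ (Y ×ˢ Y) | mulSq (t.1, t.2.1) - mulSq (t.1, t.2.2) = k} ≤
      #(k.natAbs.divisors ×ˢ k.natAbs.divisors) := by
    refine Finset.card_le_card_of_injOn (fun t => (t.1, t.2.1 + t.2.2)) ?_ ?_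
    · intro t ht
      have h := hfac t ht
      refine Finset.mem_coe.2 (Finset.mem_product.2 ⟨?_, ?_⟩) <;>
        refine Nat.mem_divisors.2 ⟨?_, Int.natAbs_ne_zero.2 hk⟩ <;>
        rw [← Int.natCast_dvd]
      · exact ⟨_, by rw [← h, mul_assoc]⟩
      · exact ⟨(t.1 : ℤ) * ((t.2.1 : ℤ) - t.2.2), by rw [← h]; ring⟩
    · intro t ht t' ht' h
      have h1 := hfac t ht
      have h2 := hfac t' ht'
      obtain ⟨h3, h4⟩ := Prod.mk.inj h
      rw [← h1, ← h3, ← h4] at h2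
      have h5 : (t.1 : ℤ) * ((t.2.1 + t.2.2 : ℕ) : ℤ) ≠ 0 := by
        intro h0
        rw [h0, zero_mul] at h1
        exact hk h1.symm
      have h6 := mul_left_cancel₀ h5 h2
      refine Prod.ext h3 (Prod.ext ?_ ?_) <;> omega
  rw [Finset.card_product] at hcard
  calc _ ≤ ((#k.natAbs.divisors * #k.natAbs.divisors : ℕ) : ℝ) := by exact_mod_cast hcard
    _ ≤ D ^ 2 := by
      push_cast
      rw [sq]
      exact mul_le_mul hD hD (by positivity) ((Nat.cast_nonneg _).trans hD)

open Finset in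
/-- The energy bound: the second moment of the number of representations `ℓ y² - ℓ' y'²`. -/
theorem sum_diffCount_sq_le (hY : Y ⊆ Icc 1 M) (hD1 : 1 ≤ D)
    (hD : ∀ n : ℕ, n ≠ 0 → n ≤ Λ * M ^ 2 → (#n.divisors : ℝ) ≤ D) (T : Finset ℤ) :
    ∑ k ∈ T, (diffCount (Icc 1 Λ ×ˢ Y) k : ℝ) ^ 2 ≤ 2 * (Λ : ℝ) ^ 3 * M ^ 2 * D ^ 2 := by
  classical
  set P := Icc 1 Λ ×ˢ Y with hP
  set ρ : ℕ → ℤ → ℕ := fun l k =>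
    #{x ∈ Y ×ˢ P | mulSq (l, x.1) - mulSq x.2 = k} with hρ
  set C : ℤ → ℕ := fun k =>
    #{t ∈ Icc 1 Λ ×ˢ (Y ×ˢ Y) | mulSq (t.1, t.2.1) - mulSq (t.1, t.2.2) = k} with hC
  have h1 : ∀ k, diffCount P k = ∑ l ∈ Icc 1 Λ, ρ l k := by
    intro k
    rw [diffCount, Finset.card_filter, Finset.sum_product, hP, Finset.sum_product, ← hP]
    refine Finset.sum_congr rfl fun l _ => ?_
    simp only [hρ]
    rw [Finset.card_filter, Finset.sum_product]
  -- Cauchy–Schwarz over ℓ makes both representations in the square share the same ℓ.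
  have h2 : ∀ k, (diffCount P k : ℝ) ^ 2 ≤ Λ * ∑ l ∈ Icc 1 Λ, ((ρ l k : ℕ) : ℝ) ^ 2 := by
    intro k
    rw [h1]
    push_cast
    refine (sq_sum_le_card_mul_sum_sq).trans (le_of_eq ?_)
    simp
  -- Rearrange ℓy² - p = ℓy'² - p' as ℓ(y² - y'²) = p - p' and count by (p, p') first.
  have h3 : ∑ l ∈ Icc 1 Λ, ∑ k ∈ T, ρ l k ^ 2 ≤ ∑ w ∈ P ×ˢ P, C (mulSq w.1 - mulSq w.2) := by
    calc _ ≤ ∑ l ∈ Icc 1 Λ, #{w ∈ (Y ×ˢ P) ×ˢ (Y ×ˢ P) |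
          mulSq (l, w.1.1) - mulSq w.1.2 = mulSq (l, w.2.1) - mulSq w.2.2} :=
          Finset.sum_le_sum fun l _ => sum_card_fiber_sq_le _ _ _
      _ = _ := by
          simp only [hC, Finset.card_filter]
          rw [Finset.sum_comm (s := P ×ˢ P), Finset.sum_product (s := Icc 1 Λ)]
          refine Finset.sum_congr rfl fun l _ => ?_
          rw [Finset.sum_product (s := Y ×ˢ P), Finset.sum_product (s := Y),
            Finset.sum_product (s := Y)]
          refine Finset.sum_congr rfl fun y _ => ?_
          have hprod : ∀ F : ℕ × ℕ × ℕ → ℕ,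
              ∑ w ∈ Y ×ˢ P, F w = ∑ y ∈ Y, ∑ p ∈ P, F (y, p) := fun F => Finset.sum_product _ _ _
          simp only [hprod]
          rw [Finset.sum_comm]
          refine Finset.sum_congr rfl fun y' _ => ?_
          rw [Finset.sum_product (s := P) (t := P)]
          refine Finset.sum_congr rfl fun p _ => Finset.sum_congr rfl fun p' _ => ?_
          refine if_congr ?_ rfl rfl
          constructor <;> intro h <;> linarith
  have hC0 : (C 0 : ℝ) ≤ Λ * M := by
    have : C 0 ≤ #(Icc 1 Λ ×ˢ Y) := by
      refine Finset.card_le_card_of_injOn (fun t => (t.1, t.2.1)) ?_ ?_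
      · intro t ht
        obtain ⟨h4, h5⟩ := Finset.mem_product.1 (Finset.mem_filter.1 (Finset.mem_coe.1 ht)).1
        exact Finset.mem_coe.2 (Finset.mem_product.2 ⟨h4, (Finset.mem_product.1 h5).1⟩)
      · have key : ∀ t ∈ ({t ∈ Icc 1 Λ ×ˢ (Y ×ˢ Y) |
            mulSq (t.1, t.2.1) - mulSq (t.1, t.2.2) = 0} : Finset (ℕ × ℕ × ℕ)),
            t.2.1 = t.2.2 := by
          intro t ht
          obtain ⟨h4, h5⟩ := Finset.mem_filter.1 ht
          have h6 := (Finset.mem_Icc.1 (Finset.mem_product.1 h4).1).1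
          simp only [mulSq] at h5
          have h7 : (t.1 : ℤ) ≠ 0 := by omega
          have h8 := mul_left_cancel₀ h7 (sub_eq_zero.1 h5)
          have h9 : t.2.1 ^ 2 = t.2.2 ^ 2 := by exact_mod_cast h8
          exact Nat.pow_left_injective two_ne_zero h9
        intro t ht t' ht' h
        obtain ⟨h4, h5⟩ := Prod.mk.inj h
        exact Prod.ext h4 (Prod.ext h5 ((key t ht).symm.trans (h5.trans (key t' ht'))))
    exact_mod_cast this.trans (card_pairs_le hY)
  have hbd : ∀ p ∈ P, 0 ≤ mulSq p ∧ mulSq p ≤ Λ * (M : ℤ) ^ 2 := by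
    intro p hp
    obtain ⟨h4, h5⟩ := Finset.mem_product.1 hp
    have h4 := (Finset.mem_Icc.1 h4).2
    have h5 := (Finset.mem_Icc.1 (hY h5)).2
    have h6 : p.1 * p.2 ^ 2 ≤ Λ * M ^ 2 := Nat.mul_le_mul h4 (Nat.pow_le_pow_left h5 2)
    refine ⟨by unfold mulSq; positivity, ?_⟩
    unfold mulSq
    exact_mod_cast h6
  have h4 : ∀ w ∈ P ×ˢ P, (C (mulSq w.1 - mulSq w.2) : ℝ) ≤
      (if mulSq w.1 - mulSq w.2 = 0 then (Λ * M : ℝ) else 0) + D ^ 2 := by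
    intro w hw
    obtain ⟨hw1, hw2⟩ := Finset.mem_product.1 hw
    have h5 := hbd _ hw1
    have h6 := hbd _ hw2
    split_ifs with h
    · rw [h]
      linarith [sq_nonneg D]
    · rw [zero_add]
      refine card_mul_sq_sub_sq_le h (hD _ (Int.natAbs_ne_zero.2 h) ?_)
      zify
      rw [abs_le]
      constructor <;> linarith
  have hP' : (#P : ℝ) ≤ Λ * M := by exact_mod_cast card_pairs_le hY
  have h5 : (∑ w ∈ P ×ˢ P, C (mulSq w.1 - mulSq w.2) : ℝ) ≤ 2 * (Λ * M) ^ 2 * D ^ 2 := by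
    refine (Finset.sum_le_sum h4).trans ?_
    rw [Finset.sum_add_distrib, Finset.sum_const, nsmul_eq_mul, ← Finset.sum_filter,
      Finset.sum_const, nsmul_eq_mul, Finset.card_product]
    have h6 : ((#{w ∈ P ×ˢ P | mulSq w.1 - mulSq w.2 = 0} : ℕ) : ℝ) ≤ Λ * M * D :=
      diffCount_zero_le hY (by linarith) hD
    have h7 : D ≤ D ^ 2 := by nlinarith
    push_cast
    calc _ ≤ (Λ * M * D ^ 2) * (Λ * M : ℝ) + (Λ * M) * (Λ * M) * D ^ 2 := by
          gcongr
          exact h6.trans (by gcongr)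
      _ = _ := by ring
  calc ∑ k ∈ T, (diffCount P k : ℝ) ^ 2
      ≤ ∑ k ∈ T, Λ * ∑ l ∈ Icc 1 Λ, ((ρ l k : ℕ) : ℝ) ^ 2 := Finset.sum_le_sum fun k _ => h2 k
    _ = Λ * ((∑ l ∈ Icc 1 Λ, ∑ k ∈ T, ρ l k ^ 2 : ℕ) : ℝ) := by
        rw [← Finset.mul_sum, Finset.sum_comm]
        push_cast
        rfl
    _ ≤ Λ * ((∑ w ∈ P ×ˢ P, C (mulSq w.1 - mulSq w.2) : ℕ) : ℝ) := by
        gcongr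
    _ ≤ Λ * (2 * (Λ * M) ^ 2 * D ^ 2) := by
        gcongr
        exact_mod_cast h5
    _ = _ := by ring


/-! ### The bilinear estimate. -/

open Finset in
/-- Opening the square of a bilinear sum and exchanging the order of summation. -/
theorem norm_sum_mul_sum_sq_le {α β : Type*} (s : Finset α) (P : Finset β) (d : α → ℂ)
    (hd : ∀ x, ‖d x‖ ≤ 1) (t : α → β → ℂ) :
    ‖∑ x ∈ s, d x * ∑ p ∈ P, t x p‖ ^ 2 ≤
      #s * ∑ w ∈ P ×ˢ P, ‖∑ x ∈ s, t x w.1 * (starRingEnd ℂ) (t x w.2)‖ := by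
  calc ‖∑ x ∈ s, d x * ∑ p ∈ P, t x p‖ ^ 2 ≤ (∑ x ∈ s, ‖∑ p ∈ P, t x p‖) ^ 2 := by
        refine pow_le_pow_left₀ (norm_nonneg _) ((norm_sum_le _ _).trans ?_) 2
        refine Finset.sum_le_sum fun x _ => ?_
        rw [norm_mul]
        exact mul_le_of_le_one_left (norm_nonneg _) (hd x)
    _ ≤ #s * ∑ x ∈ s, ‖∑ p ∈ P, t x p‖ ^ 2 := sq_sum_le_card_mul_sum_sq
    _ = #s * ‖∑ w ∈ P ×ˢ P, ∑ x ∈ s, t x w.1 * (starRingEnd ℂ) (t x w.2)‖ := by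
        congr 1
        have h : ∑ w ∈ P ×ˢ P, ∑ x ∈ s, t x w.1 * (starRingEnd ℂ) (t x w.2) =
            ((∑ x ∈ s, ‖∑ p ∈ P, t x p‖ ^ 2 : ℝ) : ℂ) := by
          rw [Finset.sum_comm]
          push_cast
          refine Finset.sum_congr rfl fun x _ => ?_
          rw [Finset.sum_product' P P (fun p p' => t x p * (starRingEnd ℂ) (t x p')),
            ← Finset.sum_mul_sum, ← map_sum, Complex.mul_conj, Complex.normSq_eq_norm_sq]
          push_cast
          rfl
        rw [h, Complex.norm_real, Real.norm_of_nonneg (Finset.sum_nonneg fun _ _ => sq_nonneg _)]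
    _ ≤ _ := by
        gcongr
        exact norm_sum_le _ _

open Finset in
theorem norm_bilinear_sq_le {q : ℕ} [NeZero q] {a : ℤ} (ha : IsCoprime a (q : ℤ)) {Λ M X : ℕ}
    {Y : Finset ℕ} (hY : Y ⊆ Icc 1 M) {J : ℕ → Finset ℕ} (hJ : ∀ y ∈ Y, J y ⊆ Icc 1 X)
    (hc : ∀ y ∈ Y, (J y : Set ℕ).OrdConnected) {c b d : ℕ → ℂ} (hc1 : ∀ l, ‖c l‖ ≤ 1)
    (hb1 : ∀ y, ‖b y‖ ≤ 1) (hd1 : ∀ x, ‖d x‖ ≤ 1) (β γ : ℝ) {D : ℝ} (hD1 : 1 ≤ D)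
    (hD : ∀ n : ℕ, n ≠ 0 → n ≤ 2 * (Λ * M ^ 2) * (X + 1) → (#n.divisors : ℝ) ≤ D) :
    ‖∑ l ∈ Icc 1 Λ, c l * ∑ y ∈ Y, b y * ∑ x ∈ J y, d x * e (l * g a q β γ ((x : ℝ) * y))‖ ^ 2 ≤
      X * (Λ * M * D * X + √(2 * (Λ : ℝ) ^ 3 * M ^ 2 * D ^ 2) *
        √(2 * (Λ * M ^ 2) * X + 2 * D * (((4 * (Λ * (M : ℝ) ^ 2) * X + 1) / q + 1) *
          (X + q * (1 + Real.log q))))) := by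
  classical
  set P := Icc 1 Λ ×ˢ Y with hP
  set H := Λ * M ^ 2 with hH
  -- The indicator of x ∈ J(y) frees the range of x from y; in a product of two terms it restricts x
  -- to an intersection of intervals.
  set t : ℕ → ℕ × ℕ → ℂ := fun x p =>
    if x ∈ J p.2 then c p.1 * b p.2 * e (p.1 * g a q β γ ((x : ℝ) * p.2)) else 0 with ht
  have hS : ∑ l ∈ Icc 1 Λ, c l * ∑ y ∈ Y, b y * ∑ x ∈ J y, d x * e (l * g a q β γ ((x : ℝ) * y)) =
      ∑ x ∈ Icc 1 X, d x * ∑ p ∈ P, t x p := by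
    simp_rw [Finset.mul_sum]
    rw [Finset.sum_comm (s := Icc 1 X), hP, Finset.sum_product]
    refine Finset.sum_congr rfl fun l _ => Finset.sum_congr rfl fun y hy => ?_
    simp only [ht, mul_ite, mul_zero]
    rw [← Finset.sum_filter, Finset.filter_mem_eq_inter, Finset.inter_eq_right.2 (hJ y hy)]
    refine Finset.sum_congr rfl fun x _ => ?_
    ring
  have hbd : ∀ p ∈ P, 0 ≤ mulSq p ∧ mulSq p ≤ H := by
    intro p hp
    obtain ⟨h4, h5⟩ := Finset.mem_product.1 hp
    have h4 := (Finset.mem_Icc.1 h4).2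
    have h5 := (Finset.mem_Icc.1 (hY h5)).2
    have h6 : p.1 * p.2 ^ 2 ≤ Λ * M ^ 2 := Nat.mul_le_mul h4 (Nat.pow_le_pow_left h5 2)
    refine ⟨by unfold mulSq; positivity, ?_⟩
    unfold mulSq
    rw [hH]
    exact_mod_cast h6
  have hmaps : ∀ w ∈ P ×ˢ P, mulSq w.1 - mulSq w.2 ∈ Icc (-(H : ℤ)) H := by
    intro w hw
    obtain ⟨h1, h2⟩ := Finset.mem_product.1 hw
    have h1 := hbd _ h1
    have h2 := hbd _ h2
    rw [Finset.mem_Icc]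
    constructor <;> linarith
  set W : ℤ → ℝ := fun h => if h = 0 then (X : ℝ) else √(weylBound q X (h * a)) with hW
  have hterm : ∀ w ∈ P ×ˢ P, ‖∑ x ∈ Icc 1 X, t x w.1 * (starRingEnd ℂ) (t x w.2)‖ ≤
      W (mulSq w.1 - mulSq w.2) := by
    intro w hw
    obtain ⟨h1, h2⟩ := Finset.mem_product.1 hw
    have hy1 := (Finset.mem_product.1 h1).2
    have hy2 := (Finset.mem_product.1 h2).2
    set K := J w.1.2 ∩ J w.2.2 with hK
    have hKX : K ⊆ Icc 1 X := Finset.inter_subset_left.trans (hJ _ hy1)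
    have hKc : (K : Set ℕ).OrdConnected := by
      rw [hK, Finset.coe_inter]
      exact (hc _ hy1).inter (hc _ hy2)
    set u : ℂ := c w.1.1 * b w.1.2 * (starRingEnd ℂ) (c w.2.1 * b w.2.2) *
      e (((w.1.1 : ℝ) - w.2.1) * γ) with hu
    have hu1 : ‖u‖ ≤ 1 := by
      rw [hu, norm_mul, norm_mul, norm_mul, RCLike.norm_conj, norm_mul, norm_e, mul_one]
      exact mul_le_one₀ (mul_le_one₀ (hc1 _) (norm_nonneg _) (hb1 _)) (by positivity)
        (mul_le_one₀ (hc1 _) (norm_nonneg _) (hb1 _))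
    have hsum : ∑ x ∈ Icc 1 X, t x w.1 * (starRingEnd ℂ) (t x w.2) = u * ∑ x ∈ K,
        e ((((mulSq w.1 - mulSq w.2) * a : ℤ) : ℝ) / q * (x : ℝ) ^ 2 +
          (((w.1.1 : ℝ) * w.1.2 - w.2.1 * w.2.2) * β) * x) := by
      rw [Finset.mul_sum, ← Finset.inter_eq_right.2 hKX, ← Finset.filter_mem_eq_inter,
        Finset.sum_filter]
      refine Finset.sum_congr rfl fun x _ => ?_
      simp only [ht, hK, Finset.mem_inter]
      by_cases hx1 : x ∈ J w.1.2 <;> by_cases hx2 : x ∈ J w.2.2 <;>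
        simp only [hx1, hx2, if_true, if_false, map_zero, mul_zero, zero_mul, and_true, and_false]
      rw [map_mul, conj_e, mul_mul_mul_comm, ← e_add, hu, mul_assoc _ (e _) (e _), ← e_add]
      congr 2
      simp only [g, mulSq]
      push_cast
      ring
    rw [hsum, norm_mul]
    refine (mul_le_of_le_one_left (norm_nonneg _) hu1).trans ?_
    simp only [hW]
    split_ifs with h
    · calc _ ≤ ∑ x ∈ K, (1 : ℝ) := (norm_sum_le _ _).trans (by simp only [norm_e, le_refl])
        _ = (#K : ℝ) := by simp
        _ ≤ X := by exact_mod_cast (Finset.card_le_card hKX).trans (by simp)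
    · exact Real.le_sqrt_of_sq_le (norm_quadratic_sum_sq_le _ _ hKX hKc)
  rw [hS]
  refine (norm_sum_mul_sum_sq_le _ _ _ hd1 _).trans ?_
  rw [Nat.card_Icc, Nat.add_sub_cancel]
  refine mul_le_mul_of_nonneg_left ?_ (Nat.cast_nonneg X)
  -- The factor X + 1 in the range of `hD`, rather than X, covers this range even when X = 0.
  have hdiv : ∀ n : ℕ, n ≠ 0 → n ≤ Λ * M ^ 2 → (#n.divisors : ℝ) ≤ D := fun n hn hn' =>
    hD n hn (hn'.trans (by nlinarith))
  have h0 : (0 : ℤ) ∈ Icc (-(H : ℤ)) H := by rw [Finset.mem_Icc]; omega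
  calc ∑ w ∈ P ×ˢ P, ‖∑ x ∈ Icc 1 X, t x w.1 * (starRingEnd ℂ) (t x w.2)‖
      ≤ ∑ w ∈ P ×ˢ P, W (mulSq w.1 - mulSq w.2) := Finset.sum_le_sum hterm
    _ = ∑ h ∈ Icc (-(H : ℤ)) H, (diffCount P h : ℝ) * W h := by
        rw [← Finset.sum_fiberwise_of_maps_to hmaps]
        refine Finset.sum_congr rfl fun h _ => ?_
        rw [Finset.sum_congr rfl (g := fun _ => W h)
            (fun w hw => by rw [(Finset.mem_filter.1 hw).2]), Finset.sum_const, nsmul_eq_mul]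
        rfl
    _ = (diffCount P 0 : ℝ) * X + ∑ h ∈ (Icc (-(H : ℤ)) H).erase 0,
          (diffCount P h : ℝ) * √(weylBound q X (h * a)) := by
        rw [← Finset.add_sum_erase _ _ h0]
        congr 1
        refine Finset.sum_congr rfl fun h hh => ?_
        simp only [hW]
        rw [if_neg (Finset.mem_erase.1 hh).1]
    _ ≤ _ := by
        refine add_le_add (mul_le_mul_of_nonneg_right
          (diffCount_zero_le hY (by linarith) hdiv) (Nat.cast_nonneg X)) ?_
        refine (Real.sum_mul_le_sqrt_mul_sqrt _ _ _).trans ?_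
        refine mul_le_mul (Real.sqrt_le_sqrt (sum_diffCount_sq_le hY hD1 hdiv _))
          (Real.sqrt_le_sqrt ?_) (Real.sqrt_nonneg _) (Real.sqrt_nonneg _)
        simp_rw [Real.sq_sqrt (weylBound_nonneg q X _)]
        refine (sum_weylBound_le ha X H (D := D) (by linarith) fun n hn hn' =>
          hD n hn (hn'.trans ?_)).trans (le_of_eq ?_)
        · exact Nat.mul_le_mul_left _ (Nat.le_succ X)
        · rw [hH]
          push_cast
          rfl


/-! ### Summation ranges and exponents of N. -/

theorem natsUpTo_subset {N Y : ℝ} (hN : 0 ≤ N) (hY : 0 < Y) {y : ℕ} (hy : y ∈ dyadic Y)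
    (I : Set ℝ) : natsUpTo (N / y) I ⊆ Finset.Icc 1 ⌊N / Y⌋₊ := by
  classical
  intro x hx
  have h1 := (Finset.mem_filter.1 hx).1
  have h2 := ((mem_dyadic hY.le y).1 hy).1
  rw [Finset.mem_Icc] at h1 ⊢
  exact ⟨h1.1, h1.2.trans (Nat.floor_le_floor (by gcongr))⟩

theorem ordConnected_natsUpTo (t : ℝ) {I : Set ℝ} (hI : I.OrdConnected) :
    (natsUpTo t I : Set ℕ).OrdConnected := by
  classical
  refine ⟨fun x hx z hz w hw => ?_⟩
  obtain ⟨h1, h2⟩ := Finset.mem_filter.1 (Finset.mem_coe.1 hx)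
  obtain ⟨h3, h4⟩ := Finset.mem_filter.1 (Finset.mem_coe.1 hz)
  rw [Finset.mem_Icc] at h1 h3
  refine Finset.mem_coe.2 (Finset.mem_filter.2
    ⟨Finset.mem_Icc.2 ⟨h1.1.trans hw.1, hw.2.trans h3.2⟩, hI.out h2 h4 ⟨?_, ?_⟩⟩)
  · exact_mod_cast hw.1
  · exact_mod_cast hw.2

/-- The second factor in the bilinear estimate, in terms of the total length `Z = L Y N`. -/
theorem weyl_mean_le {q h x D Z B l : ℝ} (hq : 1 ≤ q) (hh : 0 ≤ h) (hhZ : h ≤ 4 * Z)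
    (hD : 0 ≤ D) (hqZ : q ≤ 2 * B ^ 2 * Z) (hx : x ≤ B ^ 2 * q) (hl : 0 ≤ l) :
    2 * h + 2 * D * (((4 * h + 1) / q + 1) * (x + q * (1 + l))) ≤
      8 * Z + 2 * D * ((16 + 4 * B ^ 2) * Z * (B ^ 2 + 1 + l)) := by
  have hq0 : 0 < q := by linarith
  have h1 : ((4 * h + 1) / q + 1) * (x + q * (1 + l)) ≤
      (16 + 4 * B ^ 2) * Z * (B ^ 2 + 1 + l) := by
    -- Since x ≪ q, a factor q comes out and cancels the denominator; 1 ≤ q ≪ Z absorbs the rest.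
    calc ((4 * h + 1) / q + 1) * (x + q * (1 + l))
        ≤ ((4 * h + 1) / q + 1) * (q * (B ^ 2 + 1 + l)) := by
          refine mul_le_mul_of_nonneg_left ?_ (by positivity)
          linarith
      _ = (4 * h + 1 + q) * (B ^ 2 + 1 + l) := by field_simp
      _ ≤ _ := by
          refine mul_le_mul_of_nonneg_right ?_ (by positivity)
          linarith
  have h2 := mul_le_mul_of_nonneg_left h1 (by positivity : 0 ≤ 2 * D)
  linarith

/-- The pairs with h = 0 contribute about N^{2+κ} L/Y, and Y ≫ N^ρ leaves a saving of N^{ε/3-κ}. -/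
theorem diagonal_le {N Y B C ρ ε κ τ x u m : ℝ} (hN : 1 ≤ N) (hY : 0 < Y) (hB : 0 ≤ B)
    (hC : 0 ≤ C) (hx0 : 0 ≤ x) (hu0 : 0 ≤ u) (hm0 : 0 ≤ m) (hx : x ≤ N / Y)
    (hu : u ≤ N ^ (ρ - ε / 3)) (hm : m ≤ 2 * Y) (hYB : N ^ ρ ≤ B * Y)
    (hτ : 2 + κ - ε / 3 ≤ τ) :
    x * (u * m * (C * N ^ κ) * x) ≤ 2 * C * B * N ^ τ := by
  have hN0 : 0 < N := by linarith
  calc x * (u * m * (C * N ^ κ) * x)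
      ≤ N / Y * (N ^ (ρ - ε / 3) * (2 * Y) * (C * N ^ κ) * (N / Y)) := by gcongr
    _ = 2 * C * (N ^ 2 * N ^ κ * N ^ (-(ε / 3))) * (N ^ ρ / Y) := by
        rw [sub_eq_add_neg, Real.rpow_add hN0]
        field_simp
    _ ≤ 2 * C * (N ^ 2 * N ^ κ * N ^ (-(ε / 3))) * B := by
        gcongr
        rwa [div_le_iff₀ hY]
    _ = 2 * C * B * N ^ (2 + κ - ε / 3) := by
        rw [← Real.rpow_two, ← Real.rpow_add hN0, ← Real.rpow_add hN0, ← sub_eq_add_neg]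
        ring
    _ ≤ _ := by gcongr

/-- Here the square is about N^{3+4κ} L⁴ Y, and Y ≪ N^{1-4ρ} exactly cancels the N^{4ρ} in L⁴. -/
theorem off_diagonal_le {N Y B C C' ρ ε κ τ x E F : ℝ} (hN : 1 ≤ N) (hY : 0 < Y)
    (hC' : 0 ≤ C') (hx0 : 0 ≤ x) (hE0 : 0 ≤ E) (hF0 : 0 ≤ F) (hx : x ≤ N / Y)
    (hE : E ≤ 8 * (N ^ (ρ - ε / 3)) ^ 3 * Y ^ 2 * (C * N ^ κ) ^ 2)
    (hF : F ≤ C' * (N ^ κ) ^ 2 * (N ^ (ρ - ε / 3) * Y * N))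
    (hYB : Y ≤ B * N ^ (1 - 4 * ρ)) (hB : 0 ≤ B) (hτ : 2 + 2 * κ - 2 * ε / 3 ≤ τ) :
    x * (√E * √F) ≤ √(8 * C ^ 2 * C' * B) * N ^ τ := by
  have hN0 : 0 < N := by linarith
  have h1 : x ^ 2 * (E * F) ≤ 8 * C ^ 2 * C' * B * (N ^ τ) ^ 2 := by
    calc x ^ 2 * (E * F) ≤ (N / Y) ^ 2 * ((8 * (N ^ (ρ - ε / 3)) ^ 3 * Y ^ 2 * (C * N ^ κ) ^ 2) *
          (C' * (N ^ κ) ^ 2 * (N ^ (ρ - ε / 3) * Y * N))) := by gcongr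
      _ = 8 * C ^ 2 * C' * (N ^ 3 * (N ^ κ) ^ 4 * (N ^ (ρ - ε / 3)) ^ 4) * Y := by
          field_simp
      _ ≤ 8 * C ^ 2 * C' * (N ^ 3 * (N ^ κ) ^ 4 * (N ^ (ρ - ε / 3)) ^ 4) *
            (B * N ^ (1 - 4 * ρ)) := by gcongr
      _ = 8 * C ^ 2 * C' * B * (N ^ (2 + 2 * κ - 2 * ε / 3)) ^ 2 := by
          have h2 : N ^ 3 * (N ^ κ) ^ 4 * (N ^ (ρ - ε / 3)) ^ 4 * N ^ (1 - 4 * ρ) =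
              (N ^ (2 + 2 * κ - 2 * ε / 3)) ^ 2 := by
            simp only [← Real.rpow_natCast, ← Real.rpow_mul hN0.le, ← Real.rpow_add hN0]
            congr 1
            push_cast
            ring
          rw [← h2]
          ring
      _ ≤ _ := by gcongr
  calc x * (√E * √F) = √(x ^ 2 * (E * F)) := by
        rw [Real.sqrt_mul (sq_nonneg x), Real.sqrt_sq hx0, Real.sqrt_mul hE0]
    _ ≤ √(8 * C ^ 2 * C' * B * (N ^ τ) ^ 2) := Real.sqrt_le_sqrt h1
    _ = _ := by
        rw [Real.sqrt_mul (by positivity), Real.sqrt_sq (by positivity)]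

end TypeII

/-! ### Choice of constants and conclusion. -/

set_option maxHeartbeats 1000000 in
theorem theorem3 :
    ∃ ε₀ : ℝ, 0 < ε₀ ∧ ∀ ε : ℝ, 0 < ε → ε < ε₀ → ∀ A : ℝ, 0 < A →
      ∃ K : ℝ, ∀ (ρ : ℝ), 1 / 6 < ρ → ρ < 1 / 5 →
        ∀ (a : ℤ) (q : ℕ) (β γ N Y : ℝ), 0 < q → IsCoprime a (q : ℤ) → 1 ≤ N →
          (TypeII.L₁ ρ ε N) ^ (1 / 2 : ℝ) * N ≤ A * q →
          (q : ℝ) ≤ A * ((TypeII.L₁ ρ ε N) ^ (1 / 2 : ℝ) * N) →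
          N ^ ρ ≤ A * Y → Y ≤ A * N ^ (1 - 4 * ρ) →
          ∀ (I : ℕ → Set ℝ), (∀ y ∈ TypeII.dyadic Y, TypeII.IsSubinterval N y (I y)) →
          ∀ (c b d : ℕ → ℂ), (∀ ℓ, ‖c ℓ‖ ≤ 1) → (∀ y, ‖b y‖ ≤ 1) → (∀ x, ‖d x‖ ≤ 1) →
            ‖TypeII.bilinearSum ρ ε N Y (TypeII.g a q β γ) I c b d‖
              ≤ K * N ^ (1 - 10 * ε ^ 9) := by
  refine ⟨1 / 4, by norm_num, fun ε hε hε1 A hA => ?_⟩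
  -- The savings ε/3 - κ and 2ε/3 - 2κ both exceed ε/4, which dominates the required 20ε⁹ when ε <
  -- 1/4.
  set κ := ε / 24 with hκ
  have hκ0 : 0 < κ := by positivity
  obtain ⟨C₁, hC₁, hdiv⟩ := TypeII.exists_card_divisors_le (κ / 2) (by positivity)
  set B := max A 1 with hB
  have hB1 : 1 ≤ B := le_max_right _ _
  have hAB : A ≤ B := le_max_left _ _
  have hB0 : 0 < B := by linarith
  -- The divisor bound is used with exponent κ/2 on integers up to 16B²N², hence N^κ.
  set C₂ := C₁ * (16 * B ^ 2) ^ (κ / 2) with hC₂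
  have hC₂1 : 1 ≤ C₂ := one_le_mul_of_one_le_of_one_le hC₁
    (Real.one_le_rpow (by nlinarith) (by positivity))
  set C₃ := (2 * B) ^ (κ / 2) / (κ / 2) with hC₃
  have hC₃0 : 0 ≤ C₃ := by positivity
  set C₄ := 8 + 2 * C₂ * ((16 + 4 * B ^ 2) * (B ^ 2 + 1 + C₃)) with hC₄
  have hC₄0 : 0 ≤ C₄ := by positivity
  set K₁ := 2 * C₂ * B + √(8 * C₂ ^ 2 * C₄ * B) with hK₁
  have hK₁0 : 0 ≤ K₁ := by positivity
  refine ⟨√K₁, fun ρ hρ1 hρ2 a q β γ N Y hq ha hN hqA hqA' hYA hYA' I hI c b d hc hb hd => ?_⟩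
  have : NeZero q := ⟨hq.ne'⟩
  have hN0 : 0 < N := by linarith
  have hq1 : (1 : ℝ) ≤ q := by exact_mod_cast hq
  have hmono : ∀ s t : ℝ, s ≤ t → N ^ s ≤ N ^ t := fun s t h =>
    Real.rpow_le_rpow_of_exponent_le hN h
  have hY : 0 < Y := by
    have : 0 < A * Y := lt_of_lt_of_le (by positivity) hYA
    exact pos_of_mul_pos_right this hA.le
  have hYB : N ^ ρ ≤ B * Y := hYA.trans (by gcongr)
  have hYB' : Y ≤ B * N ^ (1 - 4 * ρ) := hYA'.trans (by gcongr)
  have hL1 : 1 ≤ TypeII.L₁ ρ ε N := by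
    have := Real.one_le_rpow hN (by linarith : 0 ≤ ρ - ε / 2)
    unfold TypeII.L₁
    linarith
  -- The lower bound on q serves to give X ≪ q, its upper bound to give q ≪ Z.
  have hNq : N ≤ B * q := by
    have := Real.one_le_rpow hL1 (by norm_num : (0 : ℝ) ≤ 1 / 2)
    calc N ≤ (TypeII.L₁ ρ ε N) ^ (1 / 2 : ℝ) * N := le_mul_of_one_le_left hN0.le this
      _ ≤ A * q := hqA
      _ ≤ B * q := by gcongr
  have hqu : (q : ℝ) ≤ 2 * B * (N ^ (ρ / 2 - ε / 4) * N) := by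
    have h1 : (TypeII.L₁ ρ ε N) ^ (1 / 2 : ℝ) ≤ 2 * N ^ (ρ / 2 - ε / 4) := by
      unfold TypeII.L₁
      rw [Real.mul_rpow (by norm_num) (by positivity), ← Real.rpow_mul hN0.le,
        show (ρ - ε / 2) * (1 / 2) = ρ / 2 - ε / 4 by ring]
      gcongr
      calc (2 : ℝ) ^ (1 / 2 : ℝ) ≤ (2 : ℝ) ^ (1 : ℝ) :=
            Real.rpow_le_rpow_of_exponent_le (by norm_num) (by norm_num)
        _ = 2 := Real.rpow_one 2
    calc (q : ℝ) ≤ A * ((TypeII.L₁ ρ ε N) ^ (1 / 2 : ℝ) * N) := hqA'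
      _ ≤ B * ((2 * N ^ (ρ / 2 - ε / 4)) * N) := by gcongr
      _ = _ := by ring
  set l := N ^ (ρ - ε / 3) with hl
  have hl0 : 0 < l := by positivity
  set Λ := ⌊TypeII.L ρ ε N⌋₊ with hΛ
  set M := ⌊2 * Y⌋₊ with hM
  set X := ⌊N / Y⌋₊ with hX
  have hΛl : (Λ : ℝ) ≤ l := Nat.floor_le hl0.le
  have hMY : (M : ℝ) ≤ 2 * Y := Nat.floor_le (by positivity)
  have hXY : (X : ℝ) ≤ N / Y := Nat.floor_le (by positivity)
  set Z := l * Y * N with hZ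
  have hYN : Y ≤ B * N := hYB'.trans (by
    have := hmono (1 - 4 * ρ) 1 (by linarith)
    rw [Real.rpow_one] at this
    gcongr)
  have hlY : l * Y ≤ B * N := by
    calc l * Y ≤ l * (B * N ^ (1 - 4 * ρ)) := by gcongr
      _ = B * N ^ (ρ - ε / 3 + (1 - 4 * ρ)) := by rw [Real.rpow_add hN0]; ring
      _ ≤ B * N ^ (1 : ℝ) := by (gcongr; linarith)
      _ = B * N := by rw [Real.rpow_one]
  set D := C₂ * N ^ κ with hD
  have hNκ : 1 ≤ N ^ κ := Real.one_le_rpow hN hκ0.le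
  have hD1 : 1 ≤ D := one_le_mul_of_one_le_of_one_le hC₂1 hNκ
  have hDdiv : ∀ n : ℕ, n ≠ 0 → n ≤ 2 * (Λ * M ^ 2) * (X + 1) → (n.divisors.card : ℝ) ≤ D := by
    intro n hn hn'
    have h1 : (n : ℝ) ≤ 16 * B ^ 2 * N ^ (2 : ℝ) := by
      calc (n : ℝ) ≤ 2 * (Λ * (M : ℝ) ^ 2) * (X + 1) := by exact_mod_cast hn'
        _ ≤ 2 * (l * (2 * Y) ^ 2) * (N / Y + 1) := by gcongr
        _ = 8 * (l * Y) * (N + Y) := by field_simp; ring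
        _ ≤ 8 * (B * N) * (B * N + B * N) := by
            gcongr
            exact le_mul_of_one_le_left hN0.le hB1
        _ = _ := by rw [Real.rpow_two]; ring
    calc (n.divisors.card : ℝ) ≤ C₁ * (n : ℝ) ^ (κ / 2) := hdiv n hn
      _ ≤ C₁ * (16 * B ^ 2 * N ^ (2 : ℝ)) ^ (κ / 2) := by gcongr
      _ = D := by
          rw [Real.mul_rpow (by positivity) (by positivity), ← Real.rpow_mul hN0.le,
            show 2 * (κ / 2) = κ by ring, hD, hC₂]
          ring
  have hlog : Real.log q ≤ C₃ * N ^ κ := by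
    have h1 : (q : ℝ) ≤ 2 * B * N ^ (2 : ℝ) := by
      calc (q : ℝ) ≤ 2 * B * (N ^ (ρ / 2 - ε / 4) * N) := hqu
        _ ≤ 2 * B * (N ^ (1 : ℝ) * N) := by (gcongr; linarith)
        _ = _ := by rw [Real.rpow_one, Real.rpow_two]; ring
    calc Real.log q ≤ (q : ℝ) ^ (κ / 2) / (κ / 2) :=
          Real.log_le_rpow_div (by positivity) (by positivity)
      _ ≤ (2 * B * N ^ (2 : ℝ)) ^ (κ / 2) / (κ / 2) := by gcongr
      _ = _ := by
          rw [Real.mul_rpow (by positivity) (by positivity), ← Real.rpow_mul hN0.le,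
            show 2 * (κ / 2) = κ by ring, hC₃]
          ring
  have hqZ : (q : ℝ) ≤ 2 * B ^ 2 * Z := by
    have h1 : N ^ (ρ / 2 - ε / 4) ≤ B * (l * Y) := by
      calc N ^ (ρ / 2 - ε / 4) ≤ N ^ (ρ - ε / 3 + ρ) := hmono _ _ (by linarith)
        _ = l * N ^ ρ := Real.rpow_add hN0 _ _
        _ ≤ l * (B * Y) := by gcongr
        _ = _ := by ring
    calc (q : ℝ) ≤ 2 * B * (N ^ (ρ / 2 - ε / 4) * N) := hqu
      _ ≤ 2 * B * (B * (l * Y) * N) := by gcongr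
      _ = _ := by rw [hZ]; ring
  have hXq : (X : ℝ) ≤ B ^ 2 * q := by
    have h1 : 1 ≤ B * Y := (Real.one_le_rpow hN (by linarith)).trans hYB
    calc (X : ℝ) ≤ N / Y := hXY
      _ ≤ B * N := by
          rw [div_le_iff₀ hY]
          nlinarith
      _ ≤ B * (B * q) := by gcongr
      _ = _ := by ring
  have hHX : (Λ : ℝ) * (M : ℝ) ^ 2 * X ≤ 4 * Z := by
    calc (Λ : ℝ) * (M : ℝ) ^ 2 * X ≤ l * (2 * Y) ^ 2 * (N / Y) := by gcongr
      _ = 4 * Z := by rw [hZ]; field_simp; ring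
  have hmain := TypeII.norm_bilinear_sq_le ha (Λ := Λ) (M := M) (X := X) (Y := TypeII.dyadic Y)
    (J := fun y => TypeII.natsUpTo (N / y) (I y))
    (fun y hy => by
      have := Finset.mem_Ioc.1 hy
      rw [Finset.mem_Icc]
      exact ⟨by omega, this.2⟩)
    (fun y hy => TypeII.natsUpTo_subset hN0.le hY hy _)
    (fun y hy => TypeII.ordConnected_natsUpTo _ (hI y hy).1) hc hb hd β γ hD1 hDdiv
  set E₁ := 2 * (Λ : ℝ) ^ 3 * M ^ 2 * D ^ 2 with hE₁
  have hE₁' : E₁ ≤ 8 * l ^ 3 * Y ^ 2 * D ^ 2 := by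
    calc E₁ ≤ 2 * l ^ 3 * (2 * Y) ^ 2 * D ^ 2 := by rw [hE₁]; gcongr
      _ = _ := by ring
  set E₂ := 2 * (Λ * (M : ℝ) ^ 2) * X + 2 * D * (((4 * (Λ * (M : ℝ) ^ 2) * X + 1) / q + 1) *
          (X + q * (1 + Real.log q))) with hE₂
  have hlogq : 0 ≤ Real.log q := Real.log_nonneg hq1
  have hE₂0 : 0 ≤ E₂ := by positivity
  have hZ0 : 0 < Z := by positivity
  have hE₂' : E₂ ≤ C₄ * (N ^ κ) ^ 2 * Z := by
    have h1 := TypeII.weyl_mean_le hq1 (by positivity) hHX (by linarith : 0 ≤ D) hqZ hXq hlogq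
    calc E₂ = 2 * (Λ * (M : ℝ) ^ 2 * X) + 2 * D * (((4 * (Λ * (M : ℝ) ^ 2 * X) + 1) / q + 1) *
          (X + q * (1 + Real.log q))) := by rw [hE₂]; ring
      _ ≤ 8 * Z + 2 * D * ((16 + 4 * B ^ 2) * Z * (B ^ 2 + 1 + Real.log q)) := h1
      _ ≤ 8 * Z * (N ^ κ) ^ 2 + 2 * D * ((16 + 4 * B ^ 2) * Z *
            ((B ^ 2 + 1) * N ^ κ + C₃ * N ^ κ)) := by
          have h2 := le_mul_of_one_le_right (by positivity : 0 ≤ 8 * Z) (one_le_pow₀ (n := 2) hNκ)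
          have h3 := le_mul_of_one_le_right (by positivity : 0 ≤ B ^ 2 + 1) hNκ
          exact add_le_add h2 (mul_le_mul_of_nonneg_left (mul_le_mul_of_nonneg_left
            (add_le_add h3 hlog) (by positivity)) (by positivity))
      _ = _ := by rw [hD, hC₄]; ring
  have hε9 : 20 * ε ^ 9 ≤ ε / 4 := by
    have : ε ^ 8 ≤ (1 / 4 : ℝ) ^ 8 := by gcongr
    calc 20 * ε ^ 9 = 20 * ε * ε ^ 8 := by ring
      _ ≤ 20 * ε * (1 / 4 : ℝ) ^ 8 := by gcongr
      _ ≤ ε / 4 := by linarith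
  have hpart1 : (X : ℝ) * (Λ * M * D * X) ≤ 2 * C₂ * B * N ^ (2 - 20 * ε ^ 9) :=
    TypeII.diagonal_le hN hY hB0.le (by linarith) (Nat.cast_nonneg _) (Nat.cast_nonneg _)
      (Nat.cast_nonneg _) hXY hΛl hMY hYB (by linarith)
  have hpart2 : (X : ℝ) * (√E₁ * √E₂) ≤ √(8 * C₂ ^ 2 * C₄ * B) * N ^ (2 - 20 * ε ^ 9) :=
    TypeII.off_diagonal_le hN hY hC₄0 (Nat.cast_nonneg _) (by positivity) hE₂0 hXY
      hE₁' hE₂' hYB' hB0.le (by linarith)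
  have hfin : ‖TypeII.bilinearSum ρ ε N Y (TypeII.g a q β γ) I c b d‖ ^ 2 ≤
      K₁ * N ^ (2 - 20 * ε ^ 9) := by
    refine hmain.trans ?_
    rw [mul_add, hK₁, add_mul]
    exact add_le_add hpart1 hpart2
  rw [← Real.sqrt_sq (norm_nonneg (TypeII.bilinearSum _ _ _ _ _ _ _ _ _))]
  refine (Real.sqrt_le_sqrt hfin).trans (le_of_eq ?_)
  rw [Real.sqrt_mul hK₁0]
  congr 1
  rw [Real.sqrt_eq_rpow, ← Real.rpow_mul hN0.le]
  congr 1
  ring
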